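/- Let $\mathfrak h$ be a finite-dimensional complex Hilbert space, $I$ a countable set and $(a_i)_{i\in I}$ operators on $\mathfrak h$ with $\sum_{i\in I}a_i^*a_i=\mathbf 1$ (strong convergence). A state is a positive semidefinite operator $\rho$ on $\mathfrak h$ with $\operatorname{tr}\rho=1$. Let $\Omega=I^{\{1,2,\dots\}}$ with the $\sigma$-field generated by the cylinder sets. For a state $\rho$ let $\mathbb P_\rho$ be the unique probability measure on $\Omega$ such that, for all $n\ge 0$ and $i_1,\dots,i_n\in I$, $$\mathbb P_\rho(\omega_1=i_1,\dots,\omega_n=i_n)=\operatorname{tr}\bigl(\rho\,a_{i_1}^*\cdots a_{i_n}^*a_{i_n}\cdots a_{i_1}\bigr),$$ and let $$\rho_n(\omega)=\frac{a_{\omega_n}\cdots a_{\omega_1}\,\rho\,a_{\omega_1}^*\cdots a_{\omega_n}^*}{\operatorname{tr}\bigl(\rho\,a_{\omega_1}^*\cdots a_{\omega_n}^*a_{\omega_n}\cdots a_{\omega_1}\bigr)},$$ which is defined $\mathbb P_\rho$-almost surely. Put $g(\sigma)=\operatorname{tr}(\sigma(\mathbf 1-\sigma))$. We say that (Pur) holds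 if for every state $\rho$ one has $\lim_{n\to\infty}g(\rho_n)=0$ $\mathbb P_\rho$-almost surely. Then the following are equivalent: 1. (Pur) does not hold; 2. there is an orthogonal projection $p$ on $\mathfrak h$ of rank at least $2$ such that for all $n\ge1$ and $i_1,\dots,i_n\in I$ there is a constant $\lambda_{i_1,\dots,i_n}\ge0$ with $$p\,a_{i_n}^*\cdots a_{i_1}^*a_{i_1}\cdots a_{i_n}\,p=\lambda_{i_1,\dots,i_n}\,p.$$ -/

import Mathlib

noncomputable section

open MeasureTheory Filter Topology
open scoped ComplexOrder

namespace QuantumTrajectory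

/-! ### Measures on sequences from consistent cylinder weights -/

section Cylinders

variable {I : Type*}

/-- The cylinder `Λ_{i_1,…,i_n}` of outcome sequences that start with the word `w = (i_1,…,i_n)`. -/
def cyl {n : ℕ} (w : Fin n → I) : Set (ℕ → I) := {ω | ∀ k : Fin n, ω k = w k}

variable [MeasurableSpace I] [DiscreteMeasurableSpace I] [Countable I]

theorem measurableSet_cyl {n : ℕ} (w : Fin n → I) : MeasurableSet (cyl w) := by
  have : cyl w = ⋂ k : Fin n, (fun ω : ℕ → I => ω k) ⁻¹' {w k} := by
    ext ω; simp [cyl]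
  rw [this]
  exact MeasurableSet.iInter fun k => measurable_pi_apply _ (measurableSet_singleton _)

/-- A word of length `n + 1`, indexed by `{0,…,n}`. -/
def ofIic {n : ℕ} (x : Finset.Iic n → I) : Fin (n + 1) → I :=
  fun k => x ⟨k, Finset.mem_Iic.2 (Nat.lt_succ_iff.1 k.2)⟩

/-- Existence of the measure with prescribed consistent cylinder weights. -/
theorem exists_measure_cyl (q : (n : ℕ) → (Fin n → I) → ENNReal)
    (h0 : ∀ w, q 0 w = 1)
    (hq : ∀ n (w : Fin n → I), ∑' i, q (n + 1) (Fin.snoc w i) = q n w) :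
    ∃ P : Measure (ℕ → I), IsProbabilityMeasure P ∧ ∀ n (w : Fin n → I), P (cyl w) = q n w := by
  classical
  have hle : ∀ n (w : Fin n → I), q n w ≤ 1 := by
    intro n
    induction n with
    | zero => intro w; rw [h0]
    | succ n ih =>
      intro w
      have h1 := ENNReal.le_tsum (f := fun i => q (n + 1) (Fin.snoc (Fin.init w) i))
        (w (Fin.last n))
      rw [hq] at h1
      rw [Fin.snoc_init_self] at h1
      exact h1.trans (ih _)
  let μ₀ : Measure I := Measure.sum fun i => q 1 (Fin.snoc (Fin.elim0 : Fin 0 → I) i) • Measure.dirac i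
  have hμ₀ : IsProbabilityMeasure μ₀ := ⟨by
    simp [μ₀, hq, h0]⟩
  have hμ₀' : ∀ i, μ₀ {i} = q 1 (Fin.snoc (Fin.elim0 : Fin 0 → I) i) := by
    intro i
    simp only [μ₀, Measure.sum_apply _ (measurableSet_singleton i), Measure.smul_apply,
      Measure.dirac_apply, smul_eq_mul]
    rw [tsum_eq_single i]
    · simp
    · intro j hj; simp [hj]
  let κf : (n : ℕ) → (Finset.Iic n → I) → Measure I := fun n x =>
    if q (n + 1) (ofIic x) = 0 then Measure.dirac (x ⟨0, by simp⟩)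
    else Measure.sum fun i =>
      (q (n + 2) (Fin.snoc (ofIic x) i) / q (n + 1) (ofIic x)) • Measure.dirac i
  let κ : (n : ℕ) → ProbabilityTheory.Kernel (Finset.Iic n → I) I := fun n =>
    ProbabilityTheory.Kernel.ofFunOfCountable (κf n)
  have hκ : ∀ n, ProbabilityTheory.IsMarkovKernel (κ n) := by
    intro n
    refine ⟨fun x => ?_⟩
    change IsProbabilityMeasure (κf n x)
    simp only [κf]
    split_ifs with h
    · infer_instance
    · refine ⟨?_⟩
      simp only [Measure.sum_apply _ MeasurableSet.univ, Measure.smul_apply, measure_univ,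
        smul_eq_mul, mul_one, div_eq_mul_inv]
      rw [ENNReal.tsum_mul_right, hq]
      exact ENNReal.mul_inv_cancel h ((hle _ _).trans_lt ENNReal.one_lt_top).ne
  have hκ' : ∀ n (x : Finset.Iic n → I) i,
      q (n + 1) (ofIic x) * κ n x {i} = q (n + 2) (Fin.snoc (ofIic x) i) := by
    intro n x i
    change _ * κf n x {i} = _
    by_cases h : q (n + 1) (ofIic x) = 0
    · have h1 := ENNReal.le_tsum (f := fun i => q (n + 2) (Fin.snoc (ofIic x) i)) i
      rw [hq, h] at h1
      rw [h, zero_mul, le_antisymm h1 bot_le]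
    · simp only [κf, if_neg h, Measure.sum_apply _ (measurableSet_singleton i),
        Measure.smul_apply, Measure.dirac_apply, smul_eq_mul]
      rw [tsum_eq_single i]
      · simp [ENNReal.mul_div_cancel h ((hle _ _).trans_lt ENNReal.one_lt_top).ne]
      · intro j hj; simp [hj]
  refine ⟨ProbabilityTheory.Kernel.trajMeasure (X := fun _ => I) μ₀ κ, inferInstance, ?_⟩
  set P := ProbabilityTheory.Kernel.trajMeasure (X := fun _ => I) μ₀ κ with hP
  have key : ∀ n (x : Finset.Iic n → I),
      P.map (Preorder.frestrictLe (π := fun _ => I) n) {x} = q (n + 1) (ofIic x) := by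
    intro n
    induction n with
    | zero =>
      intro x
      have hm : P.map (Preorder.frestrictLe (π := fun _ => I) 0)
          = μ₀.map (MeasurableEquiv.piUnique (fun _ : Finset.Iic 0 => I)).symm := by
        rw [hP, ProbabilityTheory.Kernel.trajMeasure, Measure.map_comp _ _ (by fun_prop),
          ProbabilityTheory.Kernel.traj_map_frestrictLe,
          ProbabilityTheory.Kernel.partialTraj_self, Measure.id_comp]
      rw [hm, MeasurableEquiv.map_apply]
      have : (MeasurableEquiv.piUnique (fun _ : Finset.Iic 0 => I)).symm ⁻¹' {x}
          = {x ⟨0, by simp⟩} := by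
        ext i
        simp only [Set.mem_preimage, Set.mem_singleton_iff, MeasurableEquiv.symm_apply_eq]
        rfl
      rw [this, hμ₀']
      congr 1
      ext k
      fin_cases k
      rfl
    | succ n ih =>
      intro x
      let x' : Finset.Iic n → I := Preorder.frestrictLe₂ (π := fun _ => I) (Nat.le_succ n) x
      let i : I := x ⟨n + 1, by simp⟩
      have e1 : P.map (Preorder.frestrictLe (π := fun _ => I) (n + 1)) {x}
          = P.map (fun ω => (Preorder.frestrictLe (π := fun _ => I) n ω, ω (n + 1)))
            ({x'} ×ˢ {i}) := by
        rw [Measure.map_apply (by fun_prop) (measurableSet_singleton _),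
          Measure.map_apply (by fun_prop)
            ((measurableSet_singleton _).prod (measurableSet_singleton _))]
        congr 1
        ext ω
        simp only [Set.mem_preimage, Set.mem_singleton_iff, Set.mem_prod]
        constructor
        · rintro rfl
          exact ⟨rfl, rfl⟩
        · rintro ⟨h1, h2⟩
          ext ⟨k, hk⟩
          rcases Nat.lt_or_ge n k with hlt | hge
          · have : k = n + 1 := le_antisymm (Finset.mem_Iic.1 hk) hlt
            subst this
            exact h2
          · exact congrFun h1 ⟨k, Finset.mem_Iic.2 hge⟩
      rw [e1, hP, ← ProbabilityTheory.Kernel.map_frestrictLe_trajMeasure_compProd_eq_map_trajMeasure,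
        Measure.compProd_apply_prod (measurableSet_singleton _) (measurableSet_singleton _),
        lintegral_singleton, ← hP, ih, mul_comm, hκ']
      congr 1
      ext k
      refine Fin.lastCases ?_ (fun k => ?_) k
      · simp [i, ofIic]
      · simp [x', ofIic]
  intro n w
  cases n with
  | zero =>
    have : cyl w = Set.univ := by ext ω; simp [cyl]
    rw [this, h0, measure_univ]
  | succ n =>
    let x : Finset.Iic n → I := fun k => w ⟨k, Nat.lt_succ_iff.2 (Finset.mem_Iic.1 k.2)⟩
    have hx : ofIic x = w := rfl
    have hc : cyl w = Preorder.frestrictLe (π := fun _ => I) n ⁻¹' {x} := by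
      ext ω
      simp only [cyl, Set.mem_ofPred_eq, Set.mem_preimage, Set.mem_singleton_iff, funext_iff,
        Subtype.forall]
      exact ⟨fun h k hk => h ⟨k, Nat.lt_succ_iff.2 (Finset.mem_Iic.1 hk)⟩,
        fun h k => h k (Finset.mem_Iic.2 (Nat.lt_succ_iff.1 k.2))⟩
    rw [hc, ← Measure.map_apply (by fun_prop) (measurableSet_singleton _), key, hx]

end Cylinders

/-! ### Repeated perfect measurements -/

variable {I H : Type*} [NormedAddCommGroup H] [InnerProductSpace ℂ H] [FiniteDimensional ℂ H]

/-- The normalization `∑ a_i^* a_i = 1`, with convergence in the strong operator topology. -/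
def IsKraus (a : I → Module.End ℂ H) : Prop :=
  ∀ x : H, HasSum (fun i => LinearMap.adjoint (a i) (a i x)) x

/-- Density matrices: positive semidefinite operators of unit trace. -/
def IsState (ρ : Module.End ℂ H) : Prop :=
  LinearMap.IsPositive ρ ∧ LinearMap.trace ℂ H ρ = 1

/-- `a_{i_1} ⋯ a_{i_n}` for the word `w = (i_1,…,i_n)`. -/
def prodLR (a : I → Module.End ℂ H) {n : ℕ} (w : Fin n → I) : Module.End ℂ H :=
  (List.ofFn fun k => a (w k)).prod

/-- `a_{i_n} ⋯ a_{i_1}` for the word `w = (i_1,…,i_n)`. -/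
def prodRL (a : I → Module.End ℂ H) {n : ℕ} (w : Fin n → I) : Module.End ℂ H :=
  (List.ofFn fun k => a (w k)).reverse.prod

/-- `tr(ρ a_{i_1}^* ⋯ a_{i_n}^* a_{i_n} ⋯ a_{i_1})`. -/
def outcomeWeight (a : I → Module.End ℂ H) (ρ : Module.End ℂ H) {n : ℕ} (w : Fin n → I) : ℂ :=
  LinearMap.trace ℂ H (ρ * LinearMap.adjoint (prodRL a w) * prodRL a w)

theorem prodRL_snoc (a : I → Module.End ℂ H) {n : ℕ} (w : Fin n → I) (i : I) :
    prodRL a (Fin.snoc w i : Fin (n + 1) → I) = a i * prodRL a w := by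
  simp only [prodRL]
  rw [List.ofFn_succ']
  simp

theorem adjoint_mul' (S T : Module.End ℂ H) :
    LinearMap.adjoint (S * T) = LinearMap.adjoint T * LinearMap.adjoint S :=
  LinearMap.adjoint_comp S T

theorem outcomeWeight_eq (a : I → Module.End ℂ H) (ρ : Module.End ℂ H) {n : ℕ} (w : Fin n → I) :
    outcomeWeight a ρ w
      = LinearMap.trace ℂ H (prodRL a w * ρ * LinearMap.adjoint (prodRL a w)) := by
  rw [outcomeWeight, LinearMap.trace_mul_comm, mul_assoc]

theorem outcomeWeight_nonneg (a : I → Module.End ℂ H) {ρ : Module.End ℂ H} (hρ : IsState ρ)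
    {n : ℕ} (w : Fin n → I) : 0 ≤ outcomeWeight a ρ w := by
  rw [outcomeWeight_eq, mul_assoc]
  exact (hρ.1.conj_adjoint (prodRL a w)).trace_nonneg

theorem hasSum_outcomeWeight {a : I → Module.End ℂ H} (ha : IsKraus a) (ρ : Module.End ℂ H)
    {n : ℕ} (w : Fin n → I) :
    HasSum (fun i => outcomeWeight a ρ (Fin.snoc w i : Fin (n + 1) → I)) (outcomeWeight a ρ w) := by
  let M := prodRL a w * ρ * LinearMap.adjoint (prodRL a w)
  have e : ∀ i, outcomeWeight a ρ (Fin.snoc w i : Fin (n + 1) → I)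
      = LinearMap.trace ℂ H (LinearMap.adjoint (a i) * a i * M) := by
    intro i
    rw [outcomeWeight_eq, prodRL_snoc, adjoint_mul', mul_assoc (LinearMap.adjoint (a i)),
      LinearMap.trace_mul_comm ℂ (LinearMap.adjoint (a i))]
    simp only [M, mul_assoc]
  simp only [e]
  rw [outcomeWeight_eq]
  change HasSum _ (LinearMap.trace ℂ H M)
  let b := stdOrthonormalBasis ℂ H
  simp only [LinearMap.trace_eq_sum_inner _ b]
  refine hasSum_sum fun j _ => ?_
  exact (ha (M (b j))).mapL (innerSL ℂ (b j))

section Law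

variable [MeasurableSpace I] [DiscreteMeasurableSpace I] [Countable I]

/-- `P` is a probability measure on outcome sequences and
`P(Λ_{i_1,…,i_n}) = tr(ρ a_{i_1}^* ⋯ a_{i_n}^* a_{i_n} ⋯ a_{i_1})`. -/
def IsOutcomeLaw (a : I → Module.End ℂ H) (ρ : Module.End ℂ H) (P : Measure (ℕ → I)) : Prop :=
  IsProbabilityMeasure P ∧
    ∀ (n : ℕ) (w : Fin n → I), P (cyl w) = ENNReal.ofReal (outcomeWeight a ρ w).re

theorem exists_isOutcomeLaw {a : I → Module.End ℂ H} (ha : IsKraus a) {ρ : Module.End ℂ H}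
    (hρ : IsState ρ) : ∃ P : Measure (ℕ → I), IsOutcomeLaw a ρ P := by
  refine exists_measure_cyl (fun n w => ENNReal.ofReal (outcomeWeight a ρ w).re) ?_ ?_
  · intro w
    simp [outcomeWeight, prodRL, hρ.2]
  · intro n w
    have h := Complex.hasSum_re (hasSum_outcomeWeight ha ρ w)
    rw [← ENNReal.ofReal_tsum_of_nonneg
      (fun i => (Complex.nonneg_iff.1 (outcomeWeight_nonneg a hρ _)).1) h.summable, h.tsum_eq]

theorem IsOutcomeLaw.unique {a : I → Module.End ℂ H} {ρ : Module.End ℂ H}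
    {P Q : Measure (ℕ → I)} (hP : IsOutcomeLaw a ρ P) (hQ : IsOutcomeLaw a ρ Q) : P = Q := by
  have := hP.1
  have := hQ.1
  refine IsProjectiveLimit.unique (P := fun J => P.map J.restrict) (fun _ => rfl) ?_
  have key : ∀ n : ℕ, Q.map (Preorder.frestrictLe (π := fun _ => I) n)
      = P.map (Preorder.frestrictLe (π := fun _ => I) n) := by
    intro n
    refine Measure.ext_of_singleton fun x => ?_
    have hc : Preorder.frestrictLe (π := fun _ => I) n ⁻¹' {x} = cyl (ofIic x) := by
      ext ω
      simp only [cyl, Set.mem_ofPred_eq, Set.mem_preimage, Set.mem_singleton_iff, funext_iff,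
        Subtype.forall]
      exact ⟨fun h k => h k (Finset.mem_Iic.2 (Nat.lt_succ_iff.1 k.2)),
        fun h k hk => h ⟨k, Nat.lt_succ_iff.2 (Finset.mem_Iic.1 hk)⟩⟩
    rw [Measure.map_apply (by fun_prop) (measurableSet_singleton _),
      Measure.map_apply (by fun_prop) (measurableSet_singleton _), hc, hP.2, hQ.2]
  intro J
  have hJ : J ⊆ Finset.Iic (J.sup id) := fun k hk => Finset.mem_Iic.2 (Finset.le_sup (f := id) hk)
  have h := congrArg (Measure.map (Finset.restrict₂ (π := fun _ => I) hJ)) (key (J.sup id))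
  rw [Measure.map_map (by fun_prop) (by fun_prop), Measure.map_map (by fun_prop) (by fun_prop)] at h
  exact h

/-- The law `ℙ_ρ` of the outcome sequence, for the initial state `ρ`. -/
def outcomeLaw {a : I → Module.End ℂ H} (ha : IsKraus a) {ρ : Module.End ℂ H}
    (hρ : IsState ρ) : Measure (ℕ → I) :=
  (exists_isOutcomeLaw ha hρ).choose

theorem isOutcomeLaw_outcomeLaw {a : I → Module.End ℂ H} (ha : IsKraus a) {ρ : Module.End ℂ H}
    (hρ : IsState ρ) : IsOutcomeLaw a ρ (outcomeLaw ha hρ) :=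
  (exists_isOutcomeLaw ha hρ).choose_spec

end Law

/-- The quantum trajectory `ρ_n(ω)`, the state conditional on the first `n` outcomes of `ω`. (The
value is `0` where the denominator vanishes, which is a null event.) -/
def trajectory (a : I → Module.End ℂ H) (ρ : Module.End ℂ H) (n : ℕ) (ω : ℕ → I) :
    Module.End ℂ H :=
  (outcomeWeight a ρ fun k : Fin n => ω k)⁻¹ •
    (prodRL a (fun k : Fin n => ω k) * ρ * LinearMap.adjoint (prodRL a fun k : Fin n => ω k))

/-- The linear entropy `g(ρ) = tr(ρ(1 - ρ))`. -/
def linearEntropy (ρ : Module.End ℂ H) : ℝ := (LinearMap.trace ℂ H (ρ * (1 - ρ))).re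

/-- (Pur): for every initial state `ρ`, `g(ρ_n) → 0` almost surely with respect to `ℙ_ρ`. -/
def Pur [MeasurableSpace I] [DiscreteMeasurableSpace I] [Countable I]
    {a : I → Module.End ℂ H} (ha : IsKraus a) : Prop :=
  ∀ (ρ : Module.End ℂ H) (hρ : IsState ρ), ∀ᵐ ω ∂(outcomeLaw ha hρ),
    Tendsto (fun n => linearEntropy (trajectory a ρ n ω)) atTop (𝓝 0)

/-- `p` is the orthogonal projection onto a dark subspace. -/
def IsDark (a : I → Module.End ℂ H) (p : Module.End ℂ H) : Prop :=
  LinearMap.IsSymmetricProjection p ∧ 2 ≤ Module.finrank ℂ (LinearMap.range p) ∧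
    ∀ (n : ℕ), 1 ≤ n → ∀ w : Fin n → I, ∃ c : ℝ, 0 ≤ c ∧
      p * LinearMap.adjoint (prodLR a w) * prodLR a w * p = (c : ℂ) • p

end QuantumTrajectory

end

set_option linter.unusedSectionVars false

noncomputable section

open MeasureTheory Filter Topology
open scoped ComplexOrder

namespace QuantumTrajectory

/-! ### The Hilbert–Schmidt norm, purity and defect -/

section HilbertSchmidt

variable {H : Type*} [NormedAddCommGroup H] [InnerProductSpace ℂ H] [FiniteDimensional ℂ H]

/-! Write `ρ = R R^*` and `Y_n = a_{ω_n} ⋯ a_{ω_1} R`. Then `hsSq Y_n` is the probability of the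
observed prefix and `tr ρ_n²` is `purity Y_n`, so (Pur) says that the purity tends to 1.

Since `∑_j A_j^* A_j = 1`, the normalized matrices `Y_n^* Y_n / tr(Y_n^* Y_n)` form a bounded
martingale and `purity Y_n` is its squared Hilbert–Schmidt norm, hence a bounded submartingale.
Completing the square makes this quantitative: over `k` steps the expected purity grows at least by
the expected `defect` of any fixed word of length `k` (`hsSq_mul_purity_add_defect_le_tsum`). As the
purity is at most 1, all expected defects tend to 0.

If every defect vanishes at some `X` with purity below 1, the range of `X` is dark
(`exists_isDark`). Without dark subspaces, compactness bounds a finite sum of defects below wherever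
the purity is at most `1 - δ` (`exists_pos_le_sum_defect`). Markov's inequality gives purity → 1 in
probability, and martingale convergence upgrades this to almost surely.

Conversely, started from `p / rank p` with `p` dark, `Y_n^* Y_n` remains a multiple of `p`, so the
purity is frozen at `1 / rank p ≤ 1/2`. -/

/-- The square of the Hilbert–Schmidt norm. -/
def hsSq (C : Module.End ℂ H) : ℝ := ∑ j, ‖C (stdOrthonormalBasis ℂ H j)‖ ^ 2

/-- The real part of the Hilbert–Schmidt inner product. -/
def hsInner (B C : Module.End ℂ H) : ℝ :=
  ∑ j, (inner ℂ (B (stdOrthonormalBasis ℂ H j)) (C (stdOrthonormalBasis ℂ H j))).re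

theorem trace_adjoint_mul (B C : Module.End ℂ H) :
    LinearMap.trace ℂ H (LinearMap.adjoint B * C)
      = ∑ j, inner ℂ (B (stdOrthonormalBasis ℂ H j)) (C (stdOrthonormalBasis ℂ H j)) := by
  rw [LinearMap.trace_eq_sum_inner _ (stdOrthonormalBasis ℂ H)]
  simp [LinearMap.adjoint_inner_right]

theorem trace_adjoint_mul_self (C : Module.End ℂ H) :
    LinearMap.trace ℂ H (LinearMap.adjoint C * C) = (hsSq C : ℂ) := by
  rw [trace_adjoint_mul, hsSq]
  simp [inner_self_eq_norm_sq_to_K]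

theorem hsSq_nonneg (C : Module.End ℂ H) : 0 ≤ hsSq C :=
  Finset.sum_nonneg fun _ _ => by positivity

theorem hsSq_eq_zero {C : Module.End ℂ H} (h : hsSq C = 0) : C = 0 := by
  refine (stdOrthonormalBasis ℂ H).toBasis.ext fun j => ?_
  have := (Finset.sum_eq_zero_iff_of_nonneg fun j _ => by positivity).1 h j (Finset.mem_univ j)
  simpa using this

theorem hsSq_zero : hsSq (0 : Module.End ℂ H) = 0 := by simp [hsSq]

theorem hsSq_smul (c : ℂ) (C : Module.End ℂ H) : hsSq (c • C) = ‖c‖ ^ 2 * hsSq C := by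
  simp [hsSq, norm_smul, mul_pow, Finset.mul_sum]

theorem hsSq_sub_smul (B C : Module.End ℂ H) (c : ℝ) :
    hsSq (B - (c : ℂ) • C) = hsSq B - 2 * c * hsInner B C + c ^ 2 * hsSq C := by
  simp only [hsSq, hsInner, Finset.mul_sum, ← Finset.sum_sub_distrib, ← Finset.sum_add_distrib]
  refine Finset.sum_congr rfl fun j _ => ?_
  rw [LinearMap.sub_apply, @norm_sub_sq ℂ]
  simp only [LinearMap.smul_apply, inner_smul_right, norm_smul, mul_pow]
  simp
  ring

theorem norm_adjoint_apply_sq_le (Y : Module.End ℂ H) (z : H) :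
    ‖LinearMap.adjoint Y z‖ ^ 2 ≤ hsSq Y * ‖z‖ ^ 2 := by
  rw [← (stdOrthonormalBasis ℂ H).sum_sq_norm_inner_right (LinearMap.adjoint Y z), hsSq,
    Finset.sum_mul]
  refine Finset.sum_le_sum fun j _ => ?_
  rw [LinearMap.adjoint_inner_right, ← mul_pow]
  gcongr
  exact norm_inner_le_norm _ _

theorem hsSq_adjoint (Y : Module.End ℂ H) : hsSq (LinearMap.adjoint Y) = hsSq Y := by
  rw [← Complex.ofReal_inj, ← trace_adjoint_mul_self, ← trace_adjoint_mul_self,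
    LinearMap.adjoint_adjoint, LinearMap.trace_mul_comm]

theorem norm_apply_sq_le (Y : Module.End ℂ H) (z : H) : ‖Y z‖ ^ 2 ≤ hsSq Y * ‖z‖ ^ 2 := by
  simpa [hsSq_adjoint] using norm_adjoint_apply_sq_le (LinearMap.adjoint Y) z

/-- The operator norm of `Y^*` is at most the Hilbert–Schmidt norm of `Y`. This is the bound of the
purity by 1. -/
theorem hsSq_adjoint_mul_self_le (Y : Module.End ℂ H) :
    hsSq (LinearMap.adjoint Y * Y) ≤ hsSq Y ^ 2 := by
  rw [sq (hsSq Y)]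
  conv_rhs => rw [hsSq, Finset.sum_mul]
  rw [hsSq]
  refine Finset.sum_le_sum fun j _ => ?_
  rw [mul_comm]
  exact norm_adjoint_apply_sq_le _ _

/-- A positive operator factors as `R R^*`. -/
theorem exists_eq_mul_adjoint {ρ : Module.End ℂ H} (hρ : ρ.IsPositive) :
    ∃ R : Module.End ℂ H, ρ = R * LinearMap.adjoint R := by
  have := FiniteDimensional.complete ℂ H
  have h0 : 0 ≤ LinearMap.toContinuousLinearMap ρ := by
    rw [ContinuousLinearMap.nonneg_iff_isPositive]
    exact (LinearMap.isPositive_toContinuousLinearMap_iff ρ).2 hρ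
  obtain ⟨S, hS⟩ := CStarAlgebra.nonneg_iff_eq_mul_star_self.1 h0
  refine ⟨S.toLinearMap, ?_⟩
  ext x
  exact congrArg (fun T : H →L[ℂ] H => T x) hS

theorem mul_self_of_finrank_range_le_one {B : Module.End ℂ H}
    (h : Module.finrank ℂ (LinearMap.range B) ≤ 1) :
    B * B = LinearMap.trace ℂ H B • B := by
  obtain ⟨⟨v, hv⟩, hB⟩ := finrank_le_one_iff.1 h
  choose c hc using fun x => hB ⟨B x, x, rfl⟩
  have hc' : ∀ x, B x = c x • v := fun x => (congrArg Subtype.val (hc x)).symm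
  -- `v` spans a line containing the range, so it is an eigenvector, and the only possibly nonzero
  -- eigenvalue is the trace.
  have ht : LinearMap.trace ℂ H B • v = B v := by
    rw [LinearMap.trace_eq_sum_inner _ (stdOrthonormalBasis ℂ H), Finset.sum_smul]
    conv_rhs => rw [← (stdOrthonormalBasis ℂ H).sum_repr' v, map_sum]
    refine Finset.sum_congr rfl fun j _ => ?_
    rw [map_smul, hc', inner_smul_right, smul_smul, mul_comm]
  ext x
  change B (B x) = LinearMap.trace ℂ H B • B x
  rw [hc' x, map_smul, ← ht, smul_comm]

/-- In rank at most one, `B = X^* X` satisfies `B² = (tr B) B`; taking traces turns the strict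
inequality into an equality. -/
theorem two_le_finrank_range_of_hsSq_lt {X : Module.End ℂ H}
    (h : hsSq (LinearMap.adjoint X * X) < hsSq X ^ 2) :
    2 ≤ Module.finrank ℂ (LinearMap.range X) := by
  by_contra hlt
  have h1 : Module.finrank ℂ (LinearMap.range (LinearMap.adjoint X * X)) ≤ 1 := by
    have : LinearMap.range (LinearMap.adjoint X * X)
        = (LinearMap.range X).map (LinearMap.adjoint X) := LinearMap.range_comp _ _
    rw [this]
    exact (Submodule.finrank_map_le _ _).trans (by omega)
  have h2 := congrArg (LinearMap.trace ℂ H) (mul_self_of_finrank_range_le_one h1)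
  have h3 : LinearMap.adjoint (LinearMap.adjoint X * X) = LinearMap.adjoint X * X := by
    rw [adjoint_mul', LinearMap.adjoint_adjoint]
  have h4 := trace_adjoint_mul_self (LinearMap.adjoint X * X)
  rw [h3, h2, map_smul, trace_adjoint_mul_self, smul_eq_mul, ← Complex.ofReal_mul,
    Complex.ofReal_inj] at h4
  nlinarith

end HilbertSchmidt

/-! ### Gain of purity under a normalized family of operators -/

section Families

variable {J H : Type*} [NormedAddCommGroup H] [InnerProductSpace ℂ H] [FiniteDimensional ℂ H]

theorem IsKraus.hasSum_norm_sq {a : J → Module.End ℂ H} (ha : IsKraus a) (x : H) :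
    HasSum (fun i => ‖a i x‖ ^ 2) (‖x‖ ^ 2) := by
  have h := Complex.hasSum_re ((ha x).mapL (innerSL ℂ x))
  simpa [LinearMap.adjoint_inner_right, inner_self_eq_norm_sq_to_K, ← Complex.ofReal_pow] using h

/-- Polarization of `∑ ‖A_j x‖² = ‖x‖²`. -/
theorem hasSum_inner_of_hasSum_norm_sq {A : J → Module.End ℂ H}
    (hA : ∀ x, HasSum (fun j => ‖A j x‖ ^ 2) (‖x‖ ^ 2)) (x y : H) :
    HasSum (fun j => inner ℂ (A j x) (A j y)) (inner ℂ x y) := by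
  have h : ∀ z, HasSum (fun j => (‖A j z‖ : ℂ) ^ 2) ((‖z‖ : ℂ) ^ 2) := fun z => by
    simpa using Complex.hasSum_ofReal.2 (hA z)
  simp only [inner_eq_sum_norm_sq_div_four, ← map_add, ← map_sub, ← map_smul]
  exact (((h _).sub (h _)).add (((h _).sub (h _)).mul_right _)).div_const _

/-- This is `∑_j Y^* A_j^* A_j Y = Y^* Y` paired with `B`, the martingale property in weak form. -/
theorem hasSum_hsInner {A : J → Module.End ℂ H}
    (hA : ∀ x, HasSum (fun j => ‖A j x‖ ^ 2) (‖x‖ ^ 2)) (Y B : Module.End ℂ H) :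
    HasSum (fun j => hsInner (LinearMap.adjoint (A j * Y) * (A j * Y)) B)
      (hsInner (LinearMap.adjoint Y * Y) B) := by
  simp only [hsInner]
  refine hasSum_sum fun j _ => Complex.hasSum_re ?_
  simpa [LinearMap.adjoint_inner_left, LinearMap.adjoint_inner_right] using
    hasSum_inner_of_hasSum_norm_sq hA (Y (stdOrthonormalBasis ℂ H j))
      (Y (B (stdOrthonormalBasis ℂ H j)))

theorem hasSum_hsSq {A : J → Module.End ℂ H}
    (hA : ∀ x, HasSum (fun j => ‖A j x‖ ^ 2) (‖x‖ ^ 2)) (Y : Module.End ℂ H) :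
    HasSum (fun j => hsSq (A j * Y)) (hsSq Y) :=
  hasSum_sum fun _ _ => hA _

/-- The normalized purity `tr((Y^*Y)²) / (tr Y^*Y)²`. -/
def purity (Y : Module.End ℂ H) : ℝ := hsSq (LinearMap.adjoint Y * Y) / hsSq Y ^ 2

/-- How far `Y^* A^* A Y` is from being proportional to `Y^* Y`. -/
def defect (A Y : Module.End ℂ H) : ℝ :=
  hsSq (LinearMap.adjoint (A * Y) * (A * Y)
    - ((hsSq (A * Y) / hsSq Y : ℝ) : ℂ) • (LinearMap.adjoint Y * Y)) / hsSq Y ^ 2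

theorem purity_nonneg (Y : Module.End ℂ H) : 0 ≤ purity Y :=
  div_nonneg (hsSq_nonneg _) (sq_nonneg _)

theorem purity_le_one (Y : Module.End ℂ H) : purity Y ≤ 1 :=
  div_le_one_of_le₀ (hsSq_adjoint_mul_self_le Y) (sq_nonneg _)

theorem defect_nonneg (A Y : Module.End ℂ H) : 0 ≤ defect A Y :=
  div_nonneg (hsSq_nonneg _) (sq_nonneg _)

/-- With `B_j = Y^* A_j^* A_j Y`, `s_j = tr B_j` and `t = tr B`, expand `‖B_j‖² / s_j` around `(s_j
/ t) B`. The terms linear in `(B_j, s_j)` sum to `t * purity Y`; the remainder `‖B_j - (s_j / t) B‖²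
/ s_j` is at least `t` times the defect, because `s_j ≤ t`. -/
theorem hsSq_mul_purity_add_defect_le_tsum {A : J → Module.End ℂ H}
    (hA : ∀ x, HasSum (fun j => ‖A j x‖ ^ 2) (‖x‖ ^ 2)) (Y : Module.End ℂ H) (j₀ : J) :
    hsSq Y * (purity Y + defect (A j₀) Y) ≤ ∑' j, hsSq (A j * Y) * purity (A j * Y) := by
  classical
  set t := hsSq Y with ht
  set B := LinearMap.adjoint Y * Y with hB
  rcases (hsSq_nonneg Y).eq_or_lt with h0 | hpos
  · rw [← ht] at h0
    rw [← h0, zero_mul]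
    exact tsum_nonneg fun j => mul_nonneg (hsSq_nonneg _) (purity_nonneg _)
  rw [← ht] at hpos
  have hsT := hasSum_hsSq hA Y
  have hsL : HasSum (fun j => 2 / t * hsInner (LinearMap.adjoint (A j * Y) * (A j * Y)) B
      - hsSq (A j * Y) * (hsSq B / t ^ 2)) (t * purity Y) := by
    have h := ((hasSum_hsInner hA Y B).mul_left (2 / t)).sub (hsT.mul_right (hsSq B / t ^ 2))
    have e : hsInner B B = hsSq B := by
      simp [hsInner, hsSq, inner_self_eq_norm_sq_to_K, ← Complex.ofReal_pow]
    have e' : t * purity Y = 2 / t * hsInner B B - t * (hsSq B / t ^ 2) := by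
      rw [e, purity, ← ht, ← hB]
      field_simp
      ring
    rw [e']
    exact h
  have hle : ∀ j, hsSq (A j * Y) ≤ t := fun j =>
    le_hasSum hsT j fun i _ => hsSq_nonneg _
  have hsR : Summable fun j => hsSq (A j * Y) * purity (A j * Y) :=
    hsT.summable.of_nonneg_of_le (fun j => mul_nonneg (hsSq_nonneg _) (purity_nonneg _))
      fun j => mul_le_of_le_one_right (hsSq_nonneg _) (purity_le_one _)
  have key : ∀ j, 2 / t * hsInner (LinearMap.adjoint (A j * Y) * (A j * Y)) B
      - hsSq (A j * Y) * (hsSq B / t ^ 2) + t * defect (A j) Y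
      ≤ hsSq (A j * Y) * purity (A j * Y) := by
    intro j
    rcases (hsSq_nonneg (A j * Y)).eq_or_lt with hz | hp
    · have hz' := hsSq_eq_zero hz.symm
      simp [hz', hsInner, defect, hsSq_zero]
    · rw [defect, hsSq_sub_smul, purity, ← hB, ← ht]
      set s := hsSq (A j * Y)
      set u := hsInner (LinearMap.adjoint (A j * Y) * (A j * Y)) B
      set q := hsSq (LinearMap.adjoint (A j * Y) * (A j * Y))
      have hN : 0 ≤ q - 2 * (s / t) * u + (s / t) ^ 2 * hsSq B := by
        rw [← hsSq_sub_smul]; exact hsSq_nonneg _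
      have e1 : s * (q / s ^ 2) = 2 / t * u - s * (hsSq B / t ^ 2)
          + (q - 2 * (s / t) * u + (s / t) ^ 2 * hsSq B) / s := by
        field_simp
        ring
      have e2 : t * ((q - 2 * (s / t) * u + (s / t) ^ 2 * hsSq B) / t ^ 2)
          = (q - 2 * (s / t) * u + (s / t) ^ 2 * hsSq B) / t := by
        field_simp
      rw [e1, e2]
      gcongr
      exact hle j
  -- Of the nonnegative remainders only the one at `j₀` is kept.
  have hsD : HasSum (fun j => if j = j₀ then t * defect (A j₀) Y else 0) (t * defect (A j₀) Y) :=
    hasSum_ite_eq j₀ _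
  rw [mul_add]
  refine hasSum_le (fun j => ?_) (hsL.add hsD) hsR.hasSum
  refine le_trans ?_ (key j)
  gcongr
  split_ifs with h
  · rw [h]
  · exact mul_nonneg hpos.le (defect_nonneg _ _)

end Families

section Words

variable {I H : Type*} [NormedAddCommGroup H] [InnerProductSpace ℂ H] [FiniteDimensional ℂ H]

/-! ### Products of operators along words -/

theorem prodRL_append (a : I → Module.End ℂ H) {m n : ℕ} (w : Fin m → I) (v : Fin n → I) :
    prodRL a (Fin.append w v) = prodRL a v * prodRL a w := by
  have h : (List.ofFn fun k => a (Fin.append w v k))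
      = (List.ofFn fun k => a (w k)) ++ List.ofFn fun k => a (v k) := by
    rw [← List.ofFn_fin_append]
    congr 1
    ext k : 1
    refine Fin.addCases (fun k => ?_) (fun k => ?_) k <;> simp
  simp [prodRL, h]

theorem prodLR_eq_prodRL_rev (a : I → Module.End ℂ H) {n : ℕ} (w : Fin n → I) :
    prodLR a w = prodRL a (w ∘ Fin.rev) := by
  rw [prodLR, prodRL]
  congr 1
  refine List.ext_getElem (by simp) fun k h₁ h₂ => ?_
  simp only [List.getElem_reverse, List.getElem_ofFn, List.length_ofFn, Function.comp_apply]
  simp only [List.length_ofFn] at h₁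
  congr 2
  ext
  simp only [Fin.val_rev]
  omega

theorem prodRL_eq_prodLR_rev (a : I → Module.End ℂ H) {n : ℕ} (w : Fin n → I) :
    prodRL a w = prodLR a (w ∘ Fin.rev) := by
  rw [prodLR_eq_prodRL_rev]
  congr 1
  ext k
  simp

/-- Words of a fixed length again form a normalized family, so the gain estimate covers several
steps at once. -/
theorem IsKraus.hasSum_norm_sq_prodRL {a : I → Module.End ℂ H} (ha : IsKraus a) (n : ℕ) (x : H) :
    HasSum (fun w : Fin n → I => ‖prodRL a w x‖ ^ 2) (‖x‖ ^ 2) := by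
  induction n with
  | zero =>
    convert hasSum_unique (fun w : Fin 0 → I => ‖prodRL a w x‖ ^ 2) using 1
    simp [prodRL]
  | succ n ih =>
    let e : (Fin n → I) × I ≃ (Fin (n + 1) → I) :=
      (Equiv.prodComm _ _).trans (Fin.snocEquiv fun _ => I)
    rw [← e.hasSum_iff]
    have he : ∀ p : (Fin n → I) × I, ‖prodRL a (e p) x‖ ^ 2 = ‖a p.2 (prodRL a p.1 x)‖ ^ 2 := by
      intro p
      have : e p = Fin.snoc p.1 p.2 := rfl
      rw [this, prodRL_snoc]
      rfl
    have hf : ∀ w : Fin n → I, HasSum (fun i => ‖a i (prodRL a w x)‖ ^ 2) (‖prodRL a w x‖ ^ 2) :=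
      fun w => ha.hasSum_norm_sq _
    simp only [Function.comp_def, he]
    have hs : Summable fun p : (Fin n → I) × I => ‖a p.2 (prodRL a p.1 x)‖ ^ 2 := by
      rw [summable_prod_of_nonneg fun _ => by positivity]
      refine ⟨fun w => (hf w).summable, ?_⟩
      simpa only [(hf _).tsum_eq] using ih.summable
    have h := hs.hasSum
    rwa [(h.prod_fiberwise hf).unique ih] at h

/-! ### Dark subspaces -/

/-- Zero defect means `X^* A^* A X = λ X^* X`, which says that `A^* A` compresses to `λ` on the
range of `X`. Purity below 1 excludes rank one. Reversing words is harmless since all words are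
allowed. -/
theorem exists_isDark {a : I → Module.End ℂ H} {X : Module.End ℂ H} (hX : hsSq X = 1)
    (hpur : purity X < 1) (hd : ∀ (n : ℕ) (w : Fin n → I), defect (prodRL a w) X = 0) :
    ∃ p : Module.End ℂ H, IsDark a p := by
  let K := LinearMap.range X
  have hsym : (K.starProjection : H →ₗ[ℂ] H).IsSymmetricProjection :=
    LinearMap.isSymmetricProjection_iff_eq_coe_starProjection.2 ⟨K, inferInstance, rfl⟩
  refine ⟨K.starProjection.toLinearMap, hsym, ?_, fun n _ w => ?_⟩
  · have hr : LinearMap.range (K.starProjection : H →ₗ[ℂ] H) = K := K.range_starProjection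
    rw [hr]
    refine two_le_finrank_range_of_hsSq_lt ?_
    simpa [purity, hX] using hpur
  · rw [prodLR_eq_prodRL_rev]
    set A := prodRL a (w ∘ Fin.rev) with hA
    refine ⟨hsSq (A * X), hsSq_nonneg _, ?_⟩
    have hAX : LinearMap.adjoint (A * X) * (A * X)
        = (hsSq (A * X) : ℂ) • (LinearMap.adjoint X * X) := by
      have h := hd n (w ∘ Fin.rev)
      rw [defect, hX, one_pow, div_one, div_one] at h
      exact sub_eq_zero.1 (hsSq_eq_zero h)
    ext z
    refine ext_inner_left ℂ fun y => ?_
    obtain ⟨x, hx⟩ : K.starProjection y ∈ K := K.starProjection_apply_mem y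
    obtain ⟨x', hx'⟩ : K.starProjection z ∈ K := K.starProjection_apply_mem z
    have h1 := congrArg (fun T : Module.End ℂ H => inner ℂ x (T x')) hAX
    simp only [Module.End.mul_apply, LinearMap.smul_apply, LinearMap.adjoint_inner_right,
      inner_smul_right, hx, hx'] at h1
    have h2 : ∀ u v, inner ℂ u (K.starProjection v) = inner ℂ (K.starProjection u) v :=
      fun u v => (hsym.isSymmetric u v).symm
    simp only [Module.End.mul_apply, LinearMap.smul_apply, ContinuousLinearMap.coe_coe,
      inner_smul_right]
    rw [h2, LinearMap.adjoint_inner_right, h1]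
    congr 1
    rw [← h2]
    congr 1
    exact K.starProjection_eq_self_iff.2 (K.starProjection_apply_mem z)

/-! ### A uniform lower bound for the defects -/

theorem purity_smul {c : ℂ} (hc : c ≠ 0) (Y : Module.End ℂ H) : purity (c • Y) = purity Y := by
  have hc' : ‖c‖ ≠ 0 := norm_ne_zero_iff.2 hc
  have e : LinearMap.adjoint (c • Y) * (c • Y)
      = (starRingEnd ℂ c * c) • (LinearMap.adjoint Y * Y) := by
    rw [map_smulₛₗ, smul_mul_smul_comm]
  rw [purity, purity, e, hsSq_smul, hsSq_smul, norm_mul, RCLike.norm_conj]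
  by_cases h : hsSq Y = 0
  · simp [h]
  · field_simp

/-- Together with `purity_smul`, this reduces uniform bounds to the compact unit sphere. -/
theorem defect_smul {c : ℂ} (hc : c ≠ 0) (A Y : Module.End ℂ H) :
    defect A (c • Y) = defect A Y := by
  have hc' : ‖c‖ ≠ 0 := norm_ne_zero_iff.2 hc
  have e : ∀ Z : Module.End ℂ H, LinearMap.adjoint (c • Z) * (c • Z)
      = (starRingEnd ℂ c * c) • (LinearMap.adjoint Z * Z) := fun Z => by
    rw [map_smulₛₗ, smul_mul_smul_comm]
  by_cases h : hsSq Y = 0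
  · rw [hsSq_eq_zero h, smul_zero]
  have e2 : ‖c‖ ^ 2 * hsSq (A * Y) / (‖c‖ ^ 2 * hsSq Y) = hsSq (A * Y) / hsSq Y := by
    field_simp
  rw [defect, defect, mul_smul_comm, e, e, hsSq_smul, hsSq_smul, e2, smul_comm, ← smul_sub,
    hsSq_smul, norm_mul, RCLike.norm_conj]
  field_simp

theorem continuous_hsSq_coe :
    Continuous fun T : H →L[ℂ] H => hsSq (T : H →ₗ[ℂ] H) := by
  unfold hsSq
  refine continuous_finsetSum _ fun j _ => ?_
  change Continuous fun T : H →L[ℂ] H => ‖T (stdOrthonormalBasis ℂ H j)‖ ^ 2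
  fun_prop

theorem isCompact_hsSq_sphere : IsCompact {T : H →L[ℂ] H | hsSq (T : H →ₗ[ℂ] H) = 1} := by
  have : ProperSpace (H →L[ℂ] H) := FiniteDimensional.proper ℂ _
  refine (isCompact_closedBall (0 : H →L[ℂ] H) 1).of_isClosed_subset
    (isClosed_singleton.preimage continuous_hsSq_coe) fun T hT => ?_
  rw [mem_closedBall_zero_iff]
  refine T.opNorm_le_bound zero_le_one fun x => ?_
  have h := norm_apply_sq_le (T : H →ₗ[ℂ] H) x
  rw [show hsSq (T : H →ₗ[ℂ] H) = 1 from hT] at h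
  rw [one_mul] at h ⊢
  exact le_of_sq_le_sq h (norm_nonneg _)

/-- On the compact part of the unit sphere with purity at most `1 - δ`, the open sets where some
defect is positive form a cover. A finite subcover gives `V`, and the minimum of the continuous sum
over `V` gives `ε`. -/
theorem exists_pos_le_sum_defect {ι : Type*} (A : ι → Module.End ℂ H)
    (hA : ∀ X, hsSq X = 1 → purity X < 1 → ∃ i, defect (A i) X ≠ 0) {δ : ℝ} (hδ : 0 < δ) :
    ∃ (V : Finset ι) (ε : ℝ), 0 < ε ∧ ∀ Y, hsSq Y ≠ 0 → purity Y ≤ 1 - δ →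
      ε ≤ ∑ i ∈ V, defect (A i) Y := by
  have := FiniteDimensional.complete ℂ H
  -- `S` and `F` are the purity and the defects with the denominators, equal to 1 on the sphere,
  -- removed; they are continuous everywhere.
  let S : (H →L[ℂ] H) → ℝ := fun T => hsSq ((star T * T : H →L[ℂ] H) : H →ₗ[ℂ] H)
  let F : ι → (H →L[ℂ] H) → ℝ := fun i T =>
    let B := LinearMap.toContinuousLinearMap (A i) * T
    hsSq ((star B * B - (hsSq (B : H →ₗ[ℂ] H) : ℂ) • (star T * T) : H →L[ℂ] H) : H →ₗ[ℂ] H)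
  have hS : Continuous S := continuous_hsSq_coe.comp (by fun_prop)
  have hF : ∀ i, Continuous (F i) := fun i => by
    have hB : Continuous fun T : H →L[ℂ] H =>
        hsSq ((LinearMap.toContinuousLinearMap (A i) * T : H →L[ℂ] H) : H →ₗ[ℂ] H) :=
      continuous_hsSq_coe.comp (by fun_prop)
    refine continuous_hsSq_coe.comp ?_
    fun_prop
  have hSe : ∀ T : H →L[ℂ] H, hsSq (T : H →ₗ[ℂ] H) = 1 → purity (T : H →ₗ[ℂ] H) = S T := by
    intro T hT
    rw [purity, hT, one_pow, div_one]
    rfl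
  have hFe : ∀ i (T : H →L[ℂ] H), hsSq (T : H →ₗ[ℂ] H) = 1 →
      defect (A i) (T : H →ₗ[ℂ] H) = F i T := by
    intro i T hT
    rw [defect, hT, one_pow, div_one, div_one]
    rfl
  have hF0 : ∀ i T, 0 ≤ F i T := fun i T => hsSq_nonneg _
  let K : Set (H →L[ℂ] H) := {T | hsSq (T : H →ₗ[ℂ] H) = 1} ∩ {T | S T ≤ 1 - δ}
  have hK : IsCompact K := isCompact_hsSq_sphere.inter_right (isClosed_le hS continuous_const)
  obtain ⟨V, hV⟩ := hK.elim_finite_subcover (fun i => {T | 0 < F i T})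
    (fun i => isOpen_lt continuous_const (hF i)) (fun T hT => by
      obtain ⟨i, hi⟩ := hA T hT.1 (by rw [hSe T hT.1]; linarith [show S T ≤ 1 - δ from hT.2])
      rw [hFe i T hT.1] at hi
      exact Set.mem_iUnion.2 ⟨i, (hF0 i T).lt_of_ne' hi⟩)
  have hpos : ∀ T ∈ K, 0 < ∑ i ∈ V, F i T := by
    intro T hT
    obtain ⟨i, hi, hiT⟩ := Set.mem_iUnion₂.1 (hV hT)
    exact Finset.sum_pos' (fun i _ => hF0 i T) ⟨i, hi, hiT⟩
  obtain ⟨ε, hε, hεK⟩ : ∃ ε : ℝ, 0 < ε ∧ ∀ T ∈ K, ε ≤ ∑ i ∈ V, F i T := by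
    rcases K.eq_empty_or_nonempty with h | h
    · exact ⟨1, one_pos, by simp [h]⟩
    · obtain ⟨T, hT, hmin⟩ := hK.exists_isMinOn h
        (continuous_finsetSum V fun i _ => hF i).continuousOn
      exact ⟨_, hpos T hT, fun T' hT' => hmin hT'⟩
  refine ⟨V, ε, hε, fun Y hY hYp => ?_⟩
  have hYpos : 0 < hsSq Y := (hsSq_nonneg Y).lt_of_ne' hY
  let c : ℂ := (((Real.sqrt (hsSq Y))⁻¹ : ℝ) : ℂ)
  have hc : c ≠ 0 := Complex.ofReal_ne_zero.2 (inv_ne_zero (Real.sqrt_pos.2 hYpos).ne')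
  let T : H →L[ℂ] H := LinearMap.toContinuousLinearMap (c • Y)
  have hTY : (T : H →ₗ[ℂ] H) = c • Y := rfl
  have hT1 : hsSq (T : H →ₗ[ℂ] H) = 1 := by
    rw [hTY, hsSq_smul, Complex.norm_real, Real.norm_eq_abs, sq_abs, inv_pow,
      Real.sq_sqrt hYpos.le, inv_mul_cancel₀ hY]
  have hTK : T ∈ K := ⟨hT1, by
    change S T ≤ 1 - δ
    rwa [← hSe T hT1, hTY, purity_smul hc]⟩
  refine (hεK T hTK).trans_eq (Finset.sum_congr rfl fun i _ => ?_)
  rw [← hFe i T hT1, hTY, defect_smul hc]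

end Words

/-! ### Functions of finitely many outcomes -/

section Prefixes

variable {I : Type*}

/-- The first `n` outcomes. -/
def firstOutcomes (n : ℕ) (ω : ℕ → I) : Fin n → I := fun k => ω k

theorem preimage_firstOutcomes_singleton {n : ℕ} (w : Fin n → I) :
    firstOutcomes n ⁻¹' {w} = cyl w := by
  ext ω
  simp [firstOutcomes, cyl, funext_iff]

theorem firstOutcomes_of_mem_cyl {n : ℕ} {w : Fin n → I} {ω : ℕ → I} (h : ω ∈ cyl w) :
    firstOutcomes n ω = w := funext h

theorem iUnion_cyl_subtype {n : ℕ} (T : Set (Fin n → I)) :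
    ⋃ w : T, cyl (w : Fin n → I) = firstOutcomes n ⁻¹' T := by
  simp [← preimage_firstOutcomes_singleton, ← Set.preimage_iUnion]

theorem iUnion_cyl_append {n : ℕ} (w : Fin n → I) (k : ℕ) :
    ⋃ v : Fin k → I, cyl (Fin.append w v) = cyl w := by
  ext ω
  simp only [Set.mem_iUnion]
  constructor
  · rintro ⟨v, hv⟩ j
    simpa using hv (Fin.castAdd k j)
  · intro h
    refine ⟨fun j => ω (n + j), fun j => ?_⟩
    refine Fin.addCases (fun j => ?_) (fun j => ?_) j
    · simpa using h j
    · simp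

theorem pairwise_disjoint_cyl (n : ℕ) :
    Pairwise (Function.onFun Disjoint fun w : Fin n → I => cyl w) := by
  intro w w' hne
  refine Set.disjoint_left.2 fun ω h h' => hne ?_
  rw [← firstOutcomes_of_mem_cyl h, firstOutcomes_of_mem_cyl h']

variable [MeasurableSpace I] [DiscreteMeasurableSpace I] [Countable I]

theorem measurable_firstOutcomes (n : ℕ) :
    Measurable (firstOutcomes n : (ℕ → I) → Fin n → I) :=
  measurable_pi_lambda _ fun _ => measurable_pi_apply _

/-- The filtration generated by the successive outcomes. -/
def outcomeFiltration (I : Type*) [MeasurableSpace I] [DiscreteMeasurableSpace I] [Countable I] :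
    Filtration ℕ (MeasurableSpace.pi : MeasurableSpace (ℕ → I)) where
  seq n := MeasurableSpace.comap (firstOutcomes n) ⊤
  mono' m n hmn := by
    have h : (firstOutcomes m : (ℕ → I) → Fin m → I)
        = (fun w k => w (Fin.castLE hmn k)) ∘ firstOutcomes n := rfl
    change MeasurableSpace.comap (firstOutcomes m) ⊤ ≤ _
    rw [h, ← MeasurableSpace.comap_comp]
    exact MeasurableSpace.comap_mono le_top
  le' n := by
    rintro _ ⟨T, -, rfl⟩
    exact measurable_firstOutcomes n (DiscreteMeasurableSpace.forall_measurableSet T)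

variable {P : Measure (ℕ → I)}

theorem integrable_comp_firstOutcomes [IsFiniteMeasure P] {n : ℕ} {f : (Fin n → I) → ℝ}
    (h0 : ∀ w, 0 ≤ f w) (h1 : ∀ w, f w ≤ 1) : Integrable (fun ω => f (firstOutcomes n ω)) P := by
  refine Integrable.of_bound
    ((Measurable.of_discrete (f := f)).comp (measurable_firstOutcomes n)).aestronglyMeasurable 1
    (ae_of_all _ fun ω => ?_)
  rw [Real.norm_of_nonneg (h0 _)]
  exact h1 _

theorem setIntegral_cyl_comp_firstOutcomes {n : ℕ} (f : (Fin n → I) → ℝ) (w : Fin n → I) :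
    ∫ ω in cyl w, f (firstOutcomes n ω) ∂P = P.real (cyl w) * f w := by
  rw [setIntegral_congr_fun (g := fun _ => f w) (measurableSet_cyl w)
    fun ω hω => by rw [firstOutcomes_of_mem_cyl hω]]
  simp

/-- Events of the first `n` outcomes are countable disjoint unions of cylinders, so conditional
inequalities need checking on cylinders only. -/
theorem setIntegral_preimage_le {n : ℕ} {f g : (ℕ → I) → ℝ} (hf : Integrable f P)
    (hg : Integrable g P) (h : ∀ w : Fin n → I, ∫ ω in cyl w, f ω ∂P ≤ ∫ ω in cyl w, g ω ∂P)
    (T : Set (Fin n → I)) :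
    ∫ ω in firstOutcomes n ⁻¹' T, f ω ∂P ≤ ∫ ω in firstOutcomes n ⁻¹' T, g ω ∂P := by
  have hs : ∀ {φ : (ℕ → I) → ℝ}, Integrable φ P →
      HasSum (fun w : T => ∫ ω in cyl (w : Fin n → I), φ ω ∂P)
        (∫ ω in firstOutcomes n ⁻¹' T, φ ω ∂P) := fun hφ => by
    rw [← iUnion_cyl_subtype]
    exact hasSum_integral_iUnion (fun w => measurableSet_cyl _)
      ((pairwise_disjoint_cyl n).comp_of_injective Subtype.val_injective) hφ.integrableOn
  exact hasSum_le (fun w : T => h w) (hs hf) (hs hg)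

theorem setIntegral_cyl_eq_tsum {n k : ℕ} {f : (Fin (n + k) → I) → ℝ}
    (hf : Integrable (fun ω => f (firstOutcomes (n + k) ω)) P) (w : Fin n → I) :
    ∫ ω in cyl w, f (firstOutcomes (n + k) ω) ∂P
      = ∑' v : Fin k → I, P.real (cyl (Fin.append w v)) * f (Fin.append w v) := by
  have hinj : Function.Injective fun v : Fin k → I => Fin.append w v :=
    fun v v' h => funext fun j => by simpa using congrFun h (Fin.natAdd n j)
  rw [← iUnion_cyl_append w k, integral_iUnion (fun v => measurableSet_cyl _)
    ((pairwise_disjoint_cyl (n + k)).comp_of_injective hinj) hf.integrableOn]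
  simp only [setIntegral_cyl_comp_firstOutcomes]

end Prefixes

/-! ### Almost sure behaviour of the purity -/

section Trajectories

variable {I H : Type*} [NormedAddCommGroup H] [InnerProductSpace ℂ H] [FiniteDimensional ℂ H]

theorem outcomeWeight_mul_adjoint (a : I → Module.End ℂ H) (R : Module.End ℂ H) {n : ℕ}
    (w : Fin n → I) :
    outcomeWeight a (R * LinearMap.adjoint R) w = (hsSq (prodRL a w * R) : ℂ) := by
  rw [← trace_adjoint_mul_self, adjoint_mul', outcomeWeight, mul_assoc, mul_assoc,
    LinearMap.trace_mul_comm]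
  simp only [mul_assoc]

/-- By cyclicity `tr((Y Y^*)²) = tr((Y^* Y)²)`, which moves from the state `ρ_n` to the martingale
side. -/
theorem linearEntropy_trajectory (a : I → Module.End ℂ H) (R : Module.End ℂ H) {n : ℕ}
    {ω : ℕ → I} (h : hsSq (prodRL a (firstOutcomes n ω) * R) ≠ 0) :
    linearEntropy (trajectory a (R * LinearMap.adjoint R) n ω)
      = 1 - purity (prodRL a (firstOutcomes n ω) * R) := by
  set Y := prodRL a (firstOutcomes n ω) * R with hY
  have e : trajectory a (R * LinearMap.adjoint R) n ω
      = (hsSq Y : ℂ)⁻¹ • (Y * LinearMap.adjoint Y) := by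
    rw [trajectory, outcomeWeight_mul_adjoint, hY, adjoint_mul']
    simp only [mul_assoc]
    rfl
  have e1 : LinearMap.trace ℂ H (Y * LinearMap.adjoint Y) = (hsSq Y : ℂ) := by
    rw [LinearMap.trace_mul_comm, trace_adjoint_mul_self]
  have e2 : LinearMap.trace ℂ H (Y * LinearMap.adjoint Y * (Y * LinearMap.adjoint Y))
      = (hsSq (LinearMap.adjoint Y * Y) : ℂ) := by
    rw [← trace_adjoint_mul_self, adjoint_mul' (LinearMap.adjoint Y) Y, LinearMap.adjoint_adjoint,
      mul_assoc Y, LinearMap.trace_mul_comm]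
    simp only [mul_assoc]
  have h' : (hsSq Y : ℂ) ≠ 0 := Complex.ofReal_ne_zero.2 h
  rw [linearEntropy, e, mul_sub, mul_one, smul_mul_smul_comm, map_sub, map_smul, map_smul, e1, e2,
    purity, smul_eq_mul, smul_eq_mul, inv_mul_cancel₀ h', ← Complex.ofReal_inv,
    ← Complex.ofReal_mul, ← Complex.ofReal_mul, ← Complex.ofReal_one, ← Complex.ofReal_sub,
    Complex.ofReal_re]
  field_simp

/-- The averaged later purity is still at most 1; the resulting bound makes the defects integrable.
-/
theorem purity_add_defect_le_one {J : Type*} {A : J → Module.End ℂ H}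
    (hA : ∀ x, HasSum (fun j => ‖A j x‖ ^ 2) (‖x‖ ^ 2)) (Y : Module.End ℂ H) (j : J) :
    purity Y + defect (A j) Y ≤ 1 := by
  rcases (hsSq_nonneg Y).eq_or_lt with h | h
  · simp [purity, defect, ← h]
  · refine le_of_mul_le_mul_left ?_ h
    rw [mul_one]
    refine (hsSq_mul_purity_add_defect_le_tsum hA Y j).trans ?_
    conv_rhs => rw [← (hasSum_hsSq hA Y).tsum_eq]
    have hle : ∀ i, hsSq (A i * Y) * purity (A i * Y) ≤ hsSq (A i * Y) :=
      fun i => mul_le_of_le_one_right (hsSq_nonneg _) (purity_le_one _)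
    exact Summable.tsum_le_tsum hle ((hasSum_hsSq hA Y).summable.of_nonneg_of_le
      (fun i => mul_nonneg (hsSq_nonneg _) (purity_nonneg _)) hle) (hasSum_hsSq hA Y).summable

variable [MeasurableSpace I] [DiscreteMeasurableSpace I] [Countable I]
  {a : I → Module.End ℂ H} {R : Module.End ℂ H} {P : Measure (ℕ → I)}

theorem IsOutcomeLaw.real_cyl (hP : IsOutcomeLaw a (R * LinearMap.adjoint R) P) {n : ℕ}
    (w : Fin n → I) : P.real (cyl w) = hsSq (prodRL a w * R) := by
  rw [measureReal_def, hP.2, outcomeWeight_mul_adjoint, Complex.ofReal_re,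
    ENNReal.toReal_ofReal (hsSq_nonneg _)]

theorem IsOutcomeLaw.ae_hsSq_ne_zero (hP : IsOutcomeLaw a (R * LinearMap.adjoint R) P) :
    ∀ᵐ ω ∂P, ∀ n, hsSq (prodRL a (firstOutcomes n ω) * R) ≠ 0 := by
  refine ae_all_iff.2 fun n => ?_
  have e : {ω | ¬ hsSq (prodRL a (firstOutcomes n ω) * R) ≠ 0}
      = ⋃ w : {w : Fin n → I | hsSq (prodRL a w * R) = 0}, cyl (w : Fin n → I) := by
    rw [iUnion_cyl_subtype]
    ext ω
    simp
  rw [ae_iff, e, measure_iUnion_null_iff]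
  rintro ⟨w, hw⟩
  rw [hP.2, outcomeWeight_mul_adjoint, Complex.ofReal_re, show hsSq (prodRL a w * R) = 0 from hw,
    ENNReal.ofReal_zero]

theorem integrable_purity [IsFiniteMeasure P] (n : ℕ) :
    Integrable (fun ω => purity (prodRL a (firstOutcomes n ω) * R)) P :=
  integrable_comp_firstOutcomes (f := fun w => purity (prodRL a w * R))
    (fun _ => purity_nonneg _) fun _ => purity_le_one _

theorem integrable_defect [IsFiniteMeasure P] (ha : IsKraus a) (n : ℕ) {k : ℕ} (v : Fin k → I) :
    Integrable (fun ω => defect (prodRL a v) (prodRL a (firstOutcomes n ω) * R)) P :=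
  integrable_comp_firstOutcomes (f := fun w => defect (prodRL a v) (prodRL a w * R))
    (fun _ => defect_nonneg _ _) fun w => by
      linarith [purity_add_defect_le_one (ha.hasSum_norm_sq_prodRL k) (prodRL a w * R) v,
        purity_nonneg (prodRL a w * R)]

theorem IsOutcomeLaw.setIntegral_purity_add_defect_le (ha : IsKraus a)
    (hP : IsOutcomeLaw a (R * LinearMap.adjoint R) P) (n : ℕ) {k : ℕ} (v : Fin k → I)
    (T : Set (Fin n → I)) :
    ∫ ω in firstOutcomes n ⁻¹' T, (purity (prodRL a (firstOutcomes n ω) * R)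
        + defect (prodRL a v) (prodRL a (firstOutcomes n ω) * R)) ∂P
      ≤ ∫ ω in firstOutcomes n ⁻¹' T, purity (prodRL a (firstOutcomes (n + k) ω) * R) ∂P := by
  have := hP.1
  refine setIntegral_preimage_le ((integrable_purity n).add (integrable_defect ha n v))
    (integrable_purity (n + k)) (fun w => ?_) T
  simp only [Pi.add_apply]
  rw [setIntegral_cyl_comp_firstOutcomes
      (fun w => purity (prodRL a w * R) + defect (prodRL a v) (prodRL a w * R)),
    setIntegral_cyl_eq_tsum (f := fun w => purity (prodRL a w * R)) (integrable_purity (n + k))]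
  simp only [hP.real_cyl, prodRL_append, mul_assoc]
  exact hsSq_mul_purity_add_defect_le_tsum (ha.hasSum_norm_sq_prodRL k) (prodRL a w * R) v

theorem IsOutcomeLaw.submartingale_purity (ha : IsKraus a)
    (hP : IsOutcomeLaw a (R * LinearMap.adjoint R) P) :
    Submartingale (fun n ω => purity (prodRL a (firstOutcomes n ω) * R))
      (outcomeFiltration I) P := by
  have := hP.1
  -- Any one-letter word will do, as its defect is discarded; `ω₀` only shows that one exists.
  obtain ⟨ω₀⟩ := nonempty_of_isProbabilityMeasure P
  refine submartingale_of_setIntegral_le_succ (fun n => ?_) integrable_purity fun n s hs => ?_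
  · refine Measurable.stronglyMeasurable ?_
    have h : Measurable[⊤] fun w : Fin n → I => purity (prodRL a w * R) := measurable_from_top
    exact h.comp (comap_measurable (firstOutcomes n))
  · obtain ⟨T, -, rfl⟩ := hs
    refine le_trans ?_ (hP.setIntegral_purity_add_defect_le ha n (firstOutcomes 1 ω₀) T)
    refine setIntegral_mono (integrable_purity n).integrableOn
      ((integrable_purity n).add (integrable_defect ha n _)).integrableOn fun ω => ?_
    exact le_add_of_nonneg_right (defect_nonneg _ _)

/-- Expected purities increase and are bounded by 1, so their `k`-step increments, which dominate
the expected defects, tend to 0. -/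
theorem IsOutcomeLaw.tendsto_integral_defect (ha : IsKraus a)
    (hP : IsOutcomeLaw a (R * LinearMap.adjoint R) P) {k : ℕ} (v : Fin k → I) :
    Tendsto (fun n => ∫ ω, defect (prodRL a v) (prodRL a (firstOutcomes n ω) * R) ∂P)
      atTop (𝓝 0) := by
  have := hP.1
  let m : ℕ → ℝ := fun n => ∫ ω, purity (prodRL a (firstOutcomes n ω) * R) ∂P
  have hmono : Monotone m := fun i j hij => by
    simpa using (hP.submartingale_purity ha).setIntegral_le hij MeasurableSet.univ
  have hbdd : BddAbove (Set.range m) := by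
    refine ⟨1, ?_⟩
    rintro _ ⟨n, rfl⟩
    simpa using integral_mono (μ := P) (integrable_purity n) (integrable_const (1 : ℝ))
      fun ω => purity_le_one (prodRL a (firstOutcomes n ω) * R)
  have hlim := tendsto_atTop_ciSup hmono hbdd
  have hdiff : Tendsto (fun n => m (n + k) - m n) atTop (𝓝 0) := by
    simpa using ((tendsto_add_atTop_iff_nat k).2 hlim).sub hlim
  refine squeeze_zero (fun n => integral_nonneg fun ω => defect_nonneg _ _) (fun n => ?_) hdiff
  have h := hP.setIntegral_purity_add_defect_le ha n v Set.univ
  rw [Set.preimage_univ, setIntegral_univ, setIntegral_univ,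
    integral_add (integrable_purity n) (integrable_defect ha n v)] at h
  exact le_sub_iff_add_le'.2 h

theorem IsOutcomeLaw.ae_tendsto_purity (ha : IsKraus a)
    (hP : IsOutcomeLaw a (R * LinearMap.adjoint R) P)
    (hdark : ¬ ∃ p : Module.End ℂ H, IsDark a p) :
    ∀ᵐ ω ∂P, Tendsto (fun n => purity (prodRL a (firstOutcomes n ω) * R)) atTop (𝓝 1) := by
  have := hP.1
  have hlim := (hP.submartingale_purity ha).exists_ae_tendsto_of_bdd (R := 1) fun n => by
    refine (eLpNorm_le_of_ae_bound (C := 1) (ae_of_all _ fun ω => ?_)).trans ?_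
    · rw [Real.norm_of_nonneg (purity_nonneg _)]
      exact purity_le_one _
    · simp
  have hone : TendstoInMeasure P (fun n ω => purity (prodRL a (firstOutcomes n ω) * R)) atTop
      fun _ => (1 : ℝ) := by
    rw [tendstoInMeasure_iff_measureReal_dist]
    intro δ hδ
    obtain ⟨V, ε, hε, hV⟩ := exists_pos_le_sum_defect
      (fun v : Σ k, Fin k → I => prodRL a v.2) (fun X hX hX1 => by
        by_contra! h
        exact hdark (exists_isDark hX hX1 fun n w => h ⟨n, w⟩)) hδ
    have hD : Tendsto (fun n => ε⁻¹ * ∫ ω, ∑ v ∈ V,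
        defect (prodRL a v.2) (prodRL a (firstOutcomes n ω) * R) ∂P) atTop (𝓝 0) := by
      have e : ∀ n, ∫ ω, ∑ v ∈ V, defect (prodRL a v.2) (prodRL a (firstOutcomes n ω) * R) ∂P
          = ∑ v ∈ V, ∫ ω, defect (prodRL a v.2) (prodRL a (firstOutcomes n ω) * R) ∂P :=
        fun n => integral_finsetSum _ fun v _ => integrable_defect ha n v.2
      simp only [e]
      simpa using (tendsto_finsetSum V fun v _ => hP.tendsto_integral_defect ha v.2).const_mul ε⁻¹
    refine squeeze_zero (fun n => measureReal_nonneg) (fun n => ?_) hD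
    -- Markov's inequality: up to a null set, purity at distance at least `δ` from 1 forces the sum
    -- of defects above `ε`.
    rw [le_inv_mul_iff₀ hε]
    have hint : Integrable (fun ω => ∑ v ∈ V,
        defect (prodRL a v.2) (prodRL a (firstOutcomes n ω) * R)) P :=
      integrable_finsetSum V fun v _ => integrable_defect ha n v.2
    have hnonneg : ∀ ω, 0 ≤ ∑ v ∈ V, defect (prodRL a v.2) (prodRL a (firstOutcomes n ω) * R) :=
      fun ω => Finset.sum_nonneg fun v _ => defect_nonneg _ _
    refine le_trans ?_ (mul_meas_ge_le_integral_of_nonneg (ae_of_all _ hnonneg) hint ε)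
    refine mul_le_mul_of_nonneg_left ?_ hε.le
    refine ENNReal.toReal_mono (measure_ne_top _ _) (measure_mono_ae ?_)
    filter_upwards [hP.ae_hsSq_ne_zero] with ω hω hωδ
    refine hV _ (hω n) ?_
    have h : δ ≤ dist (purity (prodRL a (firstOutcomes n ω) * R)) 1 := hωδ
    rw [dist_comm, Real.dist_eq, abs_of_nonneg (sub_nonneg.2 (purity_le_one _))] at h
    linarith
  -- The almost sure limit exists; a subsequence identifies it as 1.
  obtain ⟨ns, hns, hsub⟩ := hone.exists_seq_tendsto_ae
  filter_upwards [hlim, hsub] with ω ⟨c, hc⟩ h1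
  rwa [tendsto_nhds_unique (hc.comp hns.tendsto_atTop) h1] at hc

/-! ### The two implications -/

theorem pur_of_not_exists_isDark (ha : IsKraus a)
    (hdark : ¬ ∃ p : Module.End ℂ H, IsDark a p) : Pur ha := by
  intro ρ hρ
  have hP := isOutcomeLaw_outcomeLaw ha hρ
  generalize outcomeLaw ha hρ = P at hP
  obtain ⟨R, rfl⟩ := exists_eq_mul_adjoint hρ.1
  filter_upwards [hP.ae_tendsto_purity ha hdark, hP.ae_hsSq_ne_zero] with ω h h0
  simp only [linearEntropy_trajectory a R (h0 _)]
  simpa using h.const_sub 1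

theorem IsDark.not_pur (ha : IsKraus a) {p : Module.End ℂ H} (hp : IsDark a p) : ¬ Pur ha := by
  obtain ⟨hsym, hrank, hcond⟩ := hp
  set r := Module.finrank ℂ (LinearMap.range p) with hr
  have hr0 : (0 : ℝ) < r := by exact_mod_cast (by omega : 0 < r)
  have hadj : LinearMap.adjoint p = p := by
    rw [eq_comm, LinearMap.eq_adjoint_iff]
    exact hsym.isSymmetric
  have hpp : p * p = p := hsym.isIdempotentElem
  have htr : LinearMap.trace ℂ H p = (r : ℂ) :=
    (LinearMap.IsIdempotentElem.isProj_range p hsym.isIdempotentElem).trace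
  have hpr : hsSq p = r := by
    rw [← Complex.ofReal_inj, ← trace_adjoint_mul_self, hadj, hpp, htr, Complex.ofReal_natCast]
  -- Chosen so that `R = s p` yields the normalized projection `R R^* = p / r`.
  set s : ℝ := (Real.sqrt r)⁻¹ with hs
  have hss : s ^ 2 = (r : ℝ)⁻¹ := by rw [hs, inv_pow, Real.sq_sqrt hr0.le]
  have hs0 : (s : ℂ) ≠ 0 := Complex.ofReal_ne_zero.2 (inv_ne_zero (Real.sqrt_pos.2 hr0).ne')
  let R : Module.End ℂ H := (s : ℂ) • p
  have hstate : IsState (R * LinearMap.adjoint R) := by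
    refine ⟨?_, ?_⟩
    · simpa using! LinearMap.isPositive_one.conj_adjoint R
    · rw [LinearMap.trace_mul_comm, trace_adjoint_mul_self, hsSq_smul, hpr, Complex.norm_real,
        Real.norm_eq_abs, sq_abs, hss, inv_mul_cancel₀ hr0.ne', Complex.ofReal_one]
  intro hpur
  have hP := isOutcomeLaw_outcomeLaw ha hstate
  have := hP.1
  -- One trajectory suffices: its entropy is constant from `n = 1` on, the dark condition not
  -- covering the empty word.
  obtain ⟨ω, hω, h0⟩ := ((hpur _ hstate).and hP.ae_hsSq_ne_zero).exists
  have hval : ∀ n, 1 ≤ n → linearEntropy (trajectory a (R * LinearMap.adjoint R) n ω)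
      = 1 - (r : ℝ)⁻¹ := by
    intro n hn
    rw [linearEntropy_trajectory a R (h0 n)]
    have h0n := h0 n
    obtain ⟨c, hc, hce⟩ := hcond n hn (firstOutcomes n ω ∘ Fin.rev)
    rw [← prodRL_eq_prodLR_rev] at hce
    set A := prodRL a (firstOutcomes n ω) with hA
    have hAR : A * R = (s : ℂ) • (A * p) := mul_smul_comm _ _ _
    have hB : LinearMap.adjoint (A * p) * (A * p) = (c : ℂ) • p := by
      rw [adjoint_mul', hadj, ← hce]
      simp only [mul_assoc]
    have hAp : hsSq (A * p) = c * r := by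
      rw [← Complex.ofReal_inj, ← trace_adjoint_mul_self, hB, map_smul, htr]
      simp
    rw [hAR, hsSq_smul, hAp] at h0n
    -- The observed prefix has nonzero weight, which is a multiple of `c`.
    have hc0 : c ≠ 0 := by
      rintro rfl
      simp at h0n
    rw [hAR, purity_smul hs0, purity, hB, hsSq_smul, hAp, hpr, Complex.norm_real,
      Real.norm_eq_abs, sq_abs]
    field_simp
  have hlim : Tendsto (fun n => linearEntropy (trajectory a (R * LinearMap.adjoint R) n ω)) atTop
      (𝓝 (1 - (r : ℝ)⁻¹)) :=
    tendsto_const_nhds.congr' ((eventually_ge_atTop 1).mono fun n hn => (hval n hn).symm)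
  have h := tendsto_nhds_unique hω hlim
  have h2 : (2 : ℝ) ≤ r := by exact_mod_cast hrank
  have h3 : (r : ℝ)⁻¹ ≤ 2⁻¹ := inv_anti₀ two_pos h2
  norm_num at h3
  linarith

end Trajectories

end QuantumTrajectory

end

theorem corollary4p1 {I H : Type*} [Countable I] [MeasurableSpace I] [DiscreteMeasurableSpace I]
    [NormedAddCommGroup H] [InnerProductSpace ℂ H] [FiniteDimensional ℂ H]
    (a : I → Module.End ℂ H) (ha : QuantumTrajectory.IsKraus a) :
    ¬ QuantumTrajectory.Pur ha ↔ ∃ p : Module.End ℂ H, QuantumTrajectory.IsDark a p := by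
  refine ⟨fun h => ?_, fun ⟨p, hp⟩ => hp.not_pur ha⟩
  by_contra hdark
  exact h (QuantumTrajectory.pur_of_not_exists_isDark ha hdark)
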